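/- Consider $n\ge 1$ agents that start at time $0$ at the center of the closed unit disk in the Euclidean plane and move in the plane at unit speed. A point $P$ of the unit circle is inspected at time $t$ if, at time $t$, some agent is at a point $A$ such that no convex combination of $A$ and $P$ lies in the interior of the disk; the inspection time of $P$ is the first time at which it is inspected. A feasible solution consists of trajectories of the $n$ agents that together inspect every point of the circle, and its worst-case cost is the supremum of the inspection times of the points of the circle. Then the minimum of the worst-case cost over all feasible solutions is $$ \begin{cases} 1+\sqrt{3}+\dfrac{2\pi}{n}-\dfrac{5\pi}{6}, & n=1,2,\\[2mm] \dfrac{1}{\cos(\pi/n)}, & n\ge 3. \end{cases} $$ -/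

import Mathlib

open scoped ENNReal

noncomputable section

namespace DiskInspection

/-- The Euclidean plane; the disk is the unit disk centred at `0`, its perimeter is
`Metric.sphere 0 1`. -/
abbrev Plane : Type := EuclideanSpace ℝ (Fin 2)

/-- From the position `A` an agent inspects the point `P` if no convex combination of `A` and `P`
lies in the interior of the unit disk. -/
def Inspects (A P : Plane) : Prop :=
  Disjoint (segment ℝ A P) (Metric.ball (0 : Plane) 1)

/-- A trajectory of one agent (its position as a function of the time `t ≥ 0`; values at negative
times are never used): it starts at the centre of the disk and moves at unit speed. -/
structure IsTrajectory (γ : ℝ → Plane) : Prop where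
  start : γ 0 = 0
  unitSpeed : HasUnitSpeedOn γ (Set.Ici 0)

/-- Feasible solutions of the `n`-agent disk inspection problem: trajectories of `n` agents such
that every point of the perimeter is inspected by some agent at some time. -/
structure IsFeasible {n : ℕ} (γ : Fin n → ℝ → Plane) : Prop where
  trajectory : ∀ i, IsTrajectory (γ i)
  inspectsAll : ∀ P ∈ Metric.sphere (0 : Plane) 1, ∃ i, ∃ t, 0 ≤ t ∧ Inspects (γ i t) P

/-- The inspection time of `P`: the first time at which some agent inspects `P`
(`∞` if this never happens). -/
def inspectionTime {n : ℕ} (γ : Fin n → ℝ → Plane) (P : Plane) : ℝ≥0∞ :=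
  ⨅ (i : Fin n) (t : ℝ) (_ : 0 ≤ t ∧ Inspects (γ i t) P), ENNReal.ofReal t

/-- The worst-case inspection time: the supremum of the inspection times of all perimeter
points. -/
def worstCaseTime {n : ℕ} (γ : Fin n → ℝ → Plane) : ℝ≥0∞ :=
  ⨆ P ∈ Metric.sphere (0 : Plane) 1, inspectionTime γ P

/-- `v` is the optimal worst-case cost of the `n`-agent disk inspection problem: the minimum of the
worst-case inspection time over all feasible solutions. -/
def IsOptimalWorstCaseCost (n : ℕ) (v : ℝ≥0∞) : Prop :=
  IsLeast {c | ∃ γ : Fin n → ℝ → Plane, IsFeasible γ ∧ worstCaseTime γ = c} v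

end DiskInspection

end

noncomputable section

namespace DiskInspection

open Real MeasureTheory Metric

/-! A point P of the circle is inspected from A exactly when `1 ≤ inner ℝ A P`, so a position at
distance `1 / cos β` from the centre sees a closed arc of half-width `β`. For the lower bounds,
trajectories are replaced by polygonal paths: if the cost were below `v`, finely sampled and
slightly dilated trajectories would give lists of points that together see the whole circle along
paths of length below `v` (`exists_lists_of_worstCaseTime_lt`).

For n = 1, 2, some agent sees arcs of total measure at least 2π/n. From a position with tangent
length `τ`, seeing `m` further radians costs at least `exitCost τ m`: for `m ≤ π / 2` this is the
distance to the last tangent line, otherwise it is tangent, arc of the circle, and a final exit of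
length 1. `exitCost_step` is the Bellman inequality for this potential, and induction along the path
gives `exitCost_le_pathLength`. It remains to minimise over the first position `β`; the optimum is
`β = π / 6`. The hook-shaped trajectories attain it.

For n ≥ 3, a path of length below `1 / cos (π / n)` cannot see two vertices of one inscribed regular
n-gon. Hence n such agents see one vertex each of every n-gon, so the sets they see are closed and
partition the circle; by connectedness one agent sees everything, which is absurd. Straight rays in
n equally spaced directions attain the bound. -/

/-! ### Trigonometric inequalities for the exit cost. -/

/-- Minimal length of a path that starts at a point whose tangents to the unit circle have length
`τ` and still inspects the next `m` radians beyond the arc visible from that point. -/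
def exitCost (τ m : ℝ) : ℝ :=
  if m ≤ π / 2 then 1 - cos m + τ * sin m else τ + 1 + m - π / 2

/-- The distance of the points with polar coordinates `(1 / cos α, φ)` and `(1 / cos β, φ + d)`. -/
def polarDist (α β d : ℝ) : ℝ :=
  √(1 / cos α ^ 2 + 1 / cos β ^ 2 - 2 * cos d / (cos α * cos β))

theorem exitCost_zero (τ : ℝ) : exitCost τ 0 = 0 := by
  rw [exitCost, if_pos (by positivity)]
  simp

theorem exitCost_mono {τ m m' : ℝ} (hτ : 0 ≤ τ) (hm : 0 ≤ m) (h : m ≤ m') :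
    exitCost τ m ≤ exitCost τ m' := by
  have hpi := pi_pos
  unfold exitCost
  split_ifs with h1 h2 h2
  · have hc : cos m' ≤ cos m := cos_le_cos_of_nonneg_of_le_pi hm (by linarith) h
    have hs : sin m ≤ sin m' := sin_le_sin_of_le_of_le_pi_div_two (by linarith) h2 h
    nlinarith
  · have hc : 0 ≤ cos m := cos_nonneg_of_mem_Icc ⟨by linarith, h1⟩
    nlinarith [sin_le_one m]
  · linarith
  · linarith

/-- With half-difference `h` and midpoint `c`, the right side is `2 * sin h * cos (c - β) / cos β`.
Since `|c - β| ≤ β - h`, the quotient is at least `cos h + tan β * sin h ≥ 1 / cos h`, so the right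
side is at least `2 * tan h ≥ 2 * h`. -/
theorem sub_le_tangent_chord {a b β : ℝ} (ha : 0 ≤ a) (hab : a ≤ b) (hb : b ≤ 2 * β)
    (hβ : β < π / 2) : b - a ≤ sin b - sin a + tan β * (cos a - cos b) := by
  obtain ⟨h, rfl⟩ : ∃ h, b = a + 2 * h := ⟨(b - a) / 2, by ring⟩
  obtain ⟨c, rfl⟩ : ∃ c, a = c - h := ⟨a + h, by ring⟩
  have h0 : 0 ≤ h := by linarith
  have hcβ : 0 < cos β := cos_pos_of_mem_Ioo ⟨by linarith, hβ⟩
  have hch : 0 < cos h := cos_pos_of_mem_Ioo ⟨by linarith, by linarith⟩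
  have hsh : 0 ≤ sin h := sin_nonneg_of_nonneg_of_le_pi h0 (by linarith)
  have hβh : 0 ≤ tan β := tan_nonneg_of_nonneg_of_le_pi_div_two (by linarith) hβ.le
  have e : c - h + 2 * h = c + h := by ring
  have h1 : cos (β - h) ≤ cos (c - β) := by
    rw [← cos_abs (c - β)]
    exact cos_le_cos_of_nonneg_of_le_pi (abs_nonneg _) (by linarith)
      (abs_le.2 ⟨by linarith, by linarith⟩)
  have h2 : sin (c + h) - sin (c - h) + tan β * (cos (c - h) - cos (c + h))
      = 2 * sin h * (cos (c - β) / cos β) := by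
    rw [tan_eq_sin_div_cos, sin_add, sin_sub, cos_add, cos_sub, cos_sub]
    field_simp
    ring
  have h3 : 1 / cos h ≤ cos (c - β) / cos β := by
    have h4 : tan h ≤ tan β := by
      rcases eq_or_lt_of_le (show h ≤ β by linarith) with h' | h'
      · rw [h']
      · exact (tan_lt_tan_of_lt_of_lt_pi_div_two (by linarith) hβ h').le
    calc 1 / cos h = cos h + tan h * sin h := by
          rw [tan_eq_sin_div_cos]; field_simp; linarith [sin_sq_add_cos_sq h]
      _ ≤ cos h + tan β * sin h := by gcongr
      _ = cos (β - h) / cos β := by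
          rw [tan_eq_sin_div_cos, cos_sub]; field_simp
      _ ≤ _ := by gcongr
  have h5 : h ≤ tan h := le_tan h0 (by linarith)
  rw [e, h2]
  have h6 : 2 * sin h * (1 / cos h) ≤ 2 * sin h * (cos (c - β) / cos β) := by gcongr
  have h7 : 2 * sin h * (1 / cos h) = 2 * tan h := by rw [tan_eq_sin_div_cos]; ring
  linarith

/-- A distance dominates its projection onto any direction, here the one at angle `ω` from the first
point. -/
theorem projection_le_polarDist {α β : ℝ} (hα : 0 < cos α) (hβ : 0 < cos β) (d ω : ℝ) :
    cos (ω - d) / cos β - cos ω / cos α ≤ polarDist α β d := by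
  apply le_sqrt_of_sq_le
  have : 1 / cos α ^ 2 + 1 / cos β ^ 2 - 2 * cos d / (cos α * cos β)
      = (cos (ω - d) / cos β - cos ω / cos α) ^ 2
        + (sin (ω - d) / cos β - sin ω / cos α) ^ 2 := by
    have e : cos d = cos (ω - d) * cos ω + sin (ω - d) * sin ω := by
      rw [← cos_sub, ← cos_neg]; ring_nf
    rw [e]
    field_simp
    linear_combination - cos β ^ 2 * sin_sq_add_cos_sq ω - cos α ^ 2 * sin_sq_add_cos_sq (ω - d)
  rw [this]
  linarith [sq_nonneg (sin (ω - d) / cos β - sin ω / cos α)]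

/-- Overlapping arcs: the move uncovers `δ = d + β - α` radians beyond the arc of the first point.
Projecting the move onto a well-chosen direction bounds the drop in exit cost. -/
theorem exitCost_step_of_overlap {α β d m : ℝ} (hα : 0 ≤ α) (hα' : α < π / 2)
    (hβ' : β < π / 2) (h1 : α ≤ d + β) (h2 : d ≤ α + β) :
    exitCost (tan α) (m + (d + β - α)) ≤ polarDist α β d + exitCost (tan β) m := by
  have hcα : 0 < cos α := cos_pos_of_mem_Ioo ⟨by linarith, hα'⟩
  have hcβ : 0 < cos β := cos_pos_of_mem_Ioo ⟨by linarith, hβ'⟩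
  obtain ⟨δ, rfl⟩ : ∃ δ, d = δ + α - β := ⟨d + β - α, by ring⟩
  have key := projection_le_polarDist hcα hcβ (δ + α - β)
  rw [show δ + α - β + β - α = δ by ring]
  have hδ : 0 ≤ δ := by linarith
  have hδ' : δ ≤ 2 * β := by linarith
  have e1 : ∀ x, cos (x + α) / cos α = cos x - tan α * sin x := fun x => by
    rw [tan_eq_sin_div_cos, cos_add]; field_simp
  have e2 : ∀ x, cos (x + β) / cos β = cos x - tan β * sin x := fun x => by
    rw [tan_eq_sin_div_cos, cos_add]; field_simp
  by_cases hc : m + δ ≤ π / 2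
  -- Project onto the normal of the tangent line at the last point to be seen.
  · have := key (m + δ + α)
    rw [show m + δ + α - (δ + α - β) = m + β by ring, e1, e2] at this
    rw [exitCost, if_pos hc, exitCost, if_pos (by linarith)]
    linarith
  -- Project onto the tangent direction at the far end of the first arc; the arc walked along the
  -- circle is then compared with chords by `sub_le_tangent_chord`.
  · have := key (π / 2 + α)
    rw [show π / 2 + α - (δ + α - β) = (π / 2 - δ) + β by ring, e1, e2, cos_pi_div_two,
      sin_pi_div_two, cos_pi_div_two_sub, sin_pi_div_two_sub] at this
    rw [exitCost, if_neg hc]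
    by_cases hc' : m ≤ π / 2
    · have h3 := sub_le_tangent_chord (a := π / 2 - m) (b := δ) (by linarith) (by linarith) hδ' hβ'
      rw [sin_pi_div_two_sub, cos_pi_div_two_sub] at h3
      rw [exitCost, if_pos hc']
      linarith
    · have h3 := sub_le_tangent_chord (a := 0) (b := δ) le_rfl hδ hδ' hβ'
      rw [sin_zero, cos_zero] at h3
      rw [exitCost, if_neg hc']
      linarith

/-- Disjoint arcs reduce to touching ones: the distance grows with `d`, while the gain stays `2 *
β`. -/
theorem exitCost_step {α β d m : ℝ} (hα : 0 ≤ α) (hα' : α < π / 2) (hβ : 0 ≤ β)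
    (hβ' : β < π / 2) (h1 : α ≤ d + β) (hd : d ≤ π) :
    exitCost (tan α) (m + min (d + β - α) (2 * β)) ≤ polarDist α β d + exitCost (tan β) m := by
  rcases le_total d (α + β) with h2 | h2
  · rw [min_eq_left (by linarith)]
    exact exitCost_step_of_overlap hα hα' hβ' h1 h2
  · rw [min_eq_right (by linarith)]
    have h3 := exitCost_step_of_overlap (d := α + β) (m := m) hα hα' hβ' (by linarith) le_rfl
    rw [show α + β + β - α = 2 * β by ring] at h3
    refine h3.trans (add_le_add ?_ le_rfl)
    have hcα : 0 < cos α := cos_pos_of_mem_Ioo ⟨by linarith, hα'⟩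
    have hcβ : 0 < cos β := cos_pos_of_mem_Ioo ⟨by linarith, hβ'⟩
    have : cos d ≤ cos (α + β) := cos_le_cos_of_nonneg_of_le_pi (by linarith) hd h2
    unfold polarDist
    gcongr

/-- Since `1 / cos β + tan β = tan (π / 4 + β / 2)`, this is the tangent line of `tan` at `π / 3`,
of slope 4; equality holds at `β = π / 6`. -/
theorem sqrt_three_sub_le {β : ℝ} (hβ : 0 ≤ β) (hβ' : β < π / 2) :
    √3 - π / 3 ≤ 1 / cos β + tan β - 2 * β := by
  have hpi := pi_pos
  have hcβ : 0 < cos β := cos_pos_of_mem_Ioo ⟨by linarith, hβ'⟩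
  have h3 : √3 * √3 = 3 := mul_self_sqrt (by norm_num)
  have h30 : 0 < √3 := by positivity
  have key : ∀ x, 0 ≤ x → x < π / 2 → √3 + 4 * (x - π / 3) ≤ tan x := by
    intro x hx hx'
    have hc : 0 < cos x := cos_pos_of_mem_Ioo ⟨by linarith, hx'⟩
    obtain ⟨y, rfl⟩ : ∃ y, x = y + π / 3 := ⟨x - π / 3, by ring⟩
    have hy : 0 < cos y := cos_pos_of_mem_Ioo ⟨by linarith, by linarith⟩
    have main : y * cos y - √3 * (y * sin y) ≤ sin y := by
      rcases le_total 0 y with h0 | h0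
      · have h4 := le_tan h0 (by linarith)
        rw [tan_eq_sin_div_cos, le_div_iff₀ hy] at h4
        have h5 : 0 ≤ sin y := sin_nonneg_of_nonneg_of_le_pi h0 (by linarith)
        have : 0 ≤ √3 * (y * sin y) := by positivity
        linarith
      · obtain ⟨z, rfl⟩ : ∃ z, y = -z := ⟨-y, by ring⟩
        rw [cos_neg, sin_neg]
        have hz : 0 ≤ z := by linarith
        have h5 : 0 ≤ sin z := sin_nonneg_of_nonneg_of_le_pi hz (by linarith)
        have h6 := sin_le hz
        rw [cos_neg] at hy
        rcases le_total 1 (√3 * z) with h7 | h7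
        · nlinarith [mul_nonneg hz hy.le]
        · have h8 := one_sub_sq_div_two_le_cos (x := z)
          have h9 : 1 ≤ √3 := by rw [one_le_sqrt]; norm_num
          have h10 : sin z * (1 - √3 * z) ≤ z * (1 - √3 * z) :=
            mul_le_mul_of_nonneg_right h6 (by linarith)
          have h11 : z ≤ 1 := by nlinarith
          have h12 : z * (1 - √3 * z) ≤ z * cos z :=
            mul_le_mul_of_nonneg_left (by nlinarith) hz
          linarith
    rw [tan_eq_sin_div_cos, le_div_iff₀ hc, sin_add, cos_add, sin_pi_div_three, cos_pi_div_three]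
    have e : (√3 + 4 * (y + π / 3 - π / 3)) * (cos y * (1 / 2) - sin y * (√3 / 2))
        = (√3 * cos y - √3 * √3 * sin y) / 2 + 2 * (y * cos y - √3 * (y * sin y)) := by ring
    rw [e, h3]
    linarith
  have h := key (π / 4 + β / 2) (by linarith) (by linarith)
  have e : tan (π / 4 + β / 2) = 1 / cos β + tan β := by
    obtain ⟨x, rfl⟩ : ∃ x, β = 2 * x := ⟨β / 2, by ring⟩
    have hs : sin x < cos x := by
      rw [← sin_pi_div_two_sub]
      exact sin_lt_sin_of_lt_of_le_pi_div_two (by linarith) (by linarith) (by linarith)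
    have hc : 0 < cos x := cos_pos_of_mem_Ioo ⟨by linarith, by linarith⟩
    have h2 : 0 ≤ sin x := sin_nonneg_of_nonneg_of_le_pi (by linarith) (by linarith)
    have h2' : 0 < √2 := by positivity
    rw [tan_eq_sin_div_cos, tan_eq_sin_div_cos, show π / 4 + 2 * x / 2 = π / 4 + x by ring,
      sin_add, cos_add, sin_pi_div_four, cos_pi_div_four, sin_two_mul, cos_two_mul',
      ← add_div, ← mul_add, ← mul_sub, mul_div_mul_left _ _ (by positivity),
      div_eq_div_iff (by linarith) (by nlinarith)]
    linear_combination (cos x - sin x) * sin_sq_add_cos_sq x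
  rw [e] at h
  linarith

/-! ### Arc length on the circle of directions and visible arcs. -/

instance fact_zero_lt_two_pi : Fact (0 < 2 * π) := ⟨two_pi_pos⟩

instance : MeasureSpace Angle := inferInstanceAs (MeasureSpace (AddCircle (2 * π)))

instance : IsFiniteMeasure (volume : Measure Angle) :=
  inferInstanceAs (IsFiniteMeasure (volume : Measure (AddCircle (2 * π))))

theorem volume_real_angle_univ : (volume : Measure Angle).real Set.univ = 2 * π := by
  have h := AddCircle.measure_univ (2 * π)
  change ((volume : Measure (AddCircle (2 * π))) Set.univ).toReal = 2 * π
  rw [h, ENNReal.toReal_ofReal two_pi_pos.le]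

theorem volume_real_angle_closedBall_le (θ : Angle) {r : ℝ} (hr : 0 ≤ r) :
    (volume : Measure Angle).real (closedBall θ r) ≤ 2 * r := by
  have h := AddCircle.volume_closedBall (2 * π) (x := θ) r
  change ((volume : Measure (AddCircle (2 * π))) (closedBall (α := AddCircle (2 * π)) θ r)).toReal ≤ _
  rw [h, ENNReal.toReal_ofReal (by positivity)]
  exact min_le_right _ _

theorem norm_angle_coe_le (x : ℝ) : ‖(x : Angle)‖ ≤ |x| :=
  QuotientAddGroup.norm_mk_le_norm (S := AddSubgroup.zmultiples (2 * π)) (m := x)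

theorem norm_angle_eq (θ : Angle) : ‖θ‖ = |θ.toReal| := by
  have h := (AddCircle.norm_coe_eq_abs_iff (p := 2 * π) (x := θ.toReal) two_pi_pos.ne').2 (by
    rw [abs_of_pos two_pi_pos]; linarith [θ.abs_toReal_le_pi])
  conv_lhs => rw [← θ.coe_toReal]
  exact h

theorem norm_angle_le_pi (θ : Angle) : ‖θ‖ ≤ π := by
  rw [norm_angle_eq]; exact θ.abs_toReal_le_pi

theorem cos_norm_angle (θ : Angle) : cos ‖θ‖ = θ.cos := by
  rw [norm_angle_eq, cos_abs, Angle.cos_toReal]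

/-- The directions of the points of the unit circle inspected from `Y`. -/
def visibleArc (Y : Plane) : Set Angle :=
  {θ | 1 ≤ Y 0 * θ.cos + Y 1 * θ.sin}

/-- The point with polar coordinates `(1 / cos β, φ)`. -/
def polarPoint (φ β : ℝ) : Plane :=
  !₂[cos φ / cos β, sin φ / cos β]

theorem exists_eq_polarPoint {Y : Plane} (h : (visibleArc Y).Nonempty) :
    ∃ φ β, 0 ≤ β ∧ β < π / 2 ∧ Y = polarPoint φ β := by
  obtain ⟨θ, hθ⟩ := h
  set z : ℂ := ⟨Y 0, Y 1⟩ with hz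
  have hn : ‖z‖ ^ 2 = Y 0 ^ 2 + Y 1 ^ 2 := by
    rw [Complex.sq_norm, Complex.normSq_apply]; ring
  have h1 : 1 ≤ ‖z‖ := by
    have h2 : 1 ≤ Y 0 * θ.cos + Y 1 * θ.sin := hθ
    have h3 := θ.cos_sq_add_sin_sq
    have : 1 ≤ ‖z‖ ^ 2 := by
      rw [hn]
      nlinarith [sq_nonneg (Y 0 * θ.sin - Y 1 * θ.cos)]
    nlinarith [norm_nonneg z]
  have hc : cos (arccos (1 / ‖z‖)) = 1 / ‖z‖ :=
    cos_arccos (by linarith [show 0 ≤ 1 / ‖z‖ by positivity])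
      (by rw [div_le_one (by linarith)]; exact h1)
  refine ⟨z.arg, arccos (1 / ‖z‖), arccos_nonneg _, ?_, ?_⟩
  · rw [arccos_lt_pi_div_two]; positivity
  · have e1 := Complex.norm_mul_cos_arg z
    have e2 := Complex.norm_mul_sin_arg z
    ext i
    fin_cases i
    · change Y 0 = cos z.arg / cos (arccos (1 / ‖z‖))
      rw [hc, div_div_eq_mul_div, div_one, mul_comm, e1]
    · change Y 1 = sin z.arg / cos (arccos (1 / ‖z‖))
      rw [hc, div_div_eq_mul_div, div_one, mul_comm, e2]

theorem visibleArc_polarPoint {φ β : ℝ} (h0 : 0 ≤ β) (h : β < π / 2) :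
    visibleArc (polarPoint φ β) = closedBall (φ : Angle) β := by
  ext θ
  have hc : 0 < cos β := cos_pos_of_mem_Ioo ⟨by linarith, h⟩
  induction θ using Angle.induction_on with
  | _ x =>
  rw [mem_closedBall, dist_eq_norm, ← strictAntiOn_cos.le_iff_ge (a := β) ⟨h0, by linarith⟩
    ⟨norm_nonneg _, norm_angle_le_pi _⟩, cos_norm_angle, ← Angle.coe_sub, Angle.cos_coe, cos_sub]
  simp only [visibleArc, polarPoint, Set.mem_ofPred_eq, Angle.cos_coe, Angle.sin_coe]
  simp only [Matrix.cons_val_zero, Matrix.cons_val_one]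
  rw [← sub_nonneg, ← sub_nonneg (b := cos β)]
  have : cos φ / cos β * cos x + sin φ / cos β * sin x - 1
      = (cos x * cos φ + sin x * sin φ - cos β) / cos β := by field_simp
  rw [this, le_div_iff₀ hc, zero_mul]

theorem norm_polarPoint {φ β : ℝ} (h : 0 < cos β) : ‖polarPoint φ β‖ = 1 / cos β := by
  rw [EuclideanSpace.norm_eq, Fin.sum_univ_two]
  simp only [polarPoint, Matrix.cons_val_zero, Matrix.cons_val_one,
    norm_eq_abs, sq_abs]
  rw [div_pow, div_pow, ← add_div, cos_sq_add_sin_sq, sqrt_div zero_le_one, sqrt_one,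
    sqrt_sq h.le]

theorem dist_polarPoint {φ ψ α β : ℝ} (hα : 0 < cos α) (hβ : 0 < cos β) :
    dist (polarPoint φ α) (polarPoint ψ β) = polarDist α β (dist (ψ : Angle) φ) := by
  rw [EuclideanSpace.dist_eq, Fin.sum_univ_two, polarDist, dist_eq_norm (ψ : Angle),
    cos_norm_angle, ← Angle.coe_sub, Angle.cos_coe, cos_sub]
  simp only [polarPoint, Matrix.cons_val_zero, Matrix.cons_val_one,
    Real.dist_eq, sq_abs]
  congr 1
  field_simp
  linear_combination cos β ^ 2 * sin_sq_add_cos_sq φ + cos α ^ 2 * sin_sq_add_cos_sq ψ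

/-- When neither arc contains the other by this margin, the new part lies in the arc from `α` to `d
+ β`, measured from `φ` towards `ψ`; `σ` records the orientation. -/
theorem volume_real_closedBall_diff_le {φ ψ : Angle} {α β : ℝ} (hβ : 0 ≤ β)
    (h1 : α ≤ dist ψ φ + β) (h2 : β ≤ dist ψ φ + α) :
    (volume : Measure Angle).real (closedBall ψ β \ closedBall φ α)
      ≤ min (dist ψ φ + β - α) (2 * β) := by
  apply le_min
  · obtain ⟨σ, d, hσ, hd, rfl⟩ : ∃ σ d : ℝ, (σ = 1 ∨ σ = -1) ∧ dist ψ φ = d ∧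
        ψ = φ + ((σ * d : ℝ) : Angle) := by
      have e : ψ = φ + (((ψ - φ).toReal : ℝ) : Angle) := by simp
      rcases le_total 0 (ψ - φ).toReal with h | h
      · refine ⟨1, _, Or.inl rfl, rfl, ?_⟩
        rw [dist_eq_norm, norm_angle_eq, abs_of_nonneg h, one_mul]; exact e
      · refine ⟨-1, _, Or.inr rfl, rfl, ?_⟩
        rw [dist_eq_norm, norm_angle_eq, abs_of_nonpos h, neg_one_mul, neg_neg]; exact e
    rw [hd] at h1 h2 ⊢
    have hσ2 : σ * σ = 1 := by rcases hσ with rfl | rfl <;> norm_num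
    have hσ1 : |σ| = 1 := by rcases hσ with rfl | rfl <;> norm_num
    refine (measureReal_mono (s₂ := closedBall (φ + ((σ * d : ℝ) : Angle)
      + ((σ * ((β + α - d) / 2) : ℝ) : Angle)) ((d + β - α) / 2)) ?_).trans
      ((volume_real_angle_closedBall_le _ (by linarith)).trans (by linarith))
    rintro θ ⟨hθ, hθ'⟩
    rw [mem_closedBall, dist_eq_norm, norm_angle_eq] at hθ
    obtain ⟨s, hs⟩ : ∃ s : ℝ, s = (θ - (φ + ((σ * d : ℝ) : Angle))).toReal := ⟨_, rfl⟩
    rw [← hs] at hθ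
    have e : θ = φ + ((σ * d : ℝ) : Angle) + (s : Angle) := by rw [hs]; simp
    have hs' : |σ * s| ≤ β := by rwa [abs_mul, hσ1, one_mul]
    have h3 : α < |d + σ * s| := by
      rw [mem_closedBall, not_le] at hθ'
      refine hθ'.trans_le ?_
      have : θ - φ = ((σ * (d + σ * s) : ℝ) : Angle) := by
        rw [e, mul_add, ← mul_assoc, hσ2, one_mul, Angle.coe_add]; abel
      rw [dist_eq_norm, this]
      refine (norm_angle_coe_le _).trans ?_
      rw [abs_mul, hσ1, one_mul]
    rw [abs_le] at hs'
    -- The second arc does not protrude on the far side, because `β ≤ d + α`.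
    have h4 : α < d + σ * s := by
      rcases lt_abs.1 h3 with h | h <;> linarith
    have : θ - (φ + ((σ * d : ℝ) : Angle) + ((σ * ((β + α - d) / 2) : ℝ) : Angle))
        = ((σ * (σ * s - (β + α - d) / 2) : ℝ) : Angle) := by
      rw [e, mul_sub, ← mul_assoc, hσ2, one_mul, Angle.coe_sub]; abel
    rw [mem_closedBall, dist_eq_norm, this]
    refine (norm_angle_coe_le _).trans ?_
    rw [abs_mul, hσ1, one_mul, abs_le]
    constructor <;> linarith
  · exact (measureReal_mono Set.sdiff_subset).trans (volume_real_angle_closedBall_le _ hβ)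

/-! ### Polygonal paths and their visible sets. -/

/-- The length of the polygonal path that starts at `p` and runs through the points of a list. -/
def pathLength (p : Plane) : List Plane → ℝ
  | [] => 0
  | Y :: l => dist p Y + pathLength Y l

/-- The directions inspected from some point of a list. -/
def visibleUnion (l : List Plane) : Set Angle :=
  {θ | ∃ Y ∈ l, θ ∈ visibleArc Y}

theorem visibleUnion_nil : visibleUnion [] = ∅ := by
  simp [visibleUnion]

theorem visibleUnion_cons (Y : Plane) (l : List Plane) :
    visibleUnion (Y :: l) = visibleArc Y ∪ visibleUnion l := by
  ext θ; simp [visibleUnion]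

theorem isClosed_visibleArc (Y : Plane) : IsClosed (visibleArc Y) :=
  isClosed_le continuous_const
    ((continuous_const.mul Angle.continuous_cos).add (continuous_const.mul Angle.continuous_sin))

theorem isClosed_visibleUnion (l : List Plane) : IsClosed (visibleUnion l) := by
  induction l with
  | nil => rw [visibleUnion_nil]; exact isClosed_empty
  | cons Y l ih => rw [visibleUnion_cons]; exact (isClosed_visibleArc Y).union ih

theorem pathLength_nonneg (p : Plane) (l : List Plane) : 0 ≤ pathLength p l := by
  induction l generalizing p with
  | nil => exact le_rfl
  | cons Y l ih => exact add_nonneg dist_nonneg (ih Y)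

theorem pathLength_le_dist_add (p q : Plane) (l : List Plane) :
    pathLength p l ≤ dist p q + pathLength q l := by
  cases l with
  | nil => exact add_nonneg dist_nonneg le_rfl
  | cons Y l =>
    have := dist_triangle p q Y
    simp only [pathLength]
    linarith

theorem dist_le_pathLength {Y : Plane} {l : List Plane} (h : Y ∈ l) (p : Plane) :
    dist p Y ≤ pathLength p l := by
  induction l generalizing p with
  | nil => simp at h
  | cons Z l ih =>
    rcases List.mem_cons.1 h with rfl | h
    · exact le_add_of_nonneg_right (pathLength_nonneg _ _)
    · exact (dist_triangle p Z Y).trans (add_le_add le_rfl (ih h Z))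

theorem two_dist_le_pathLength {X Y : Plane} {l : List Plane} (hX : X ∈ l) (hY : Y ∈ l)
    (p : Plane) :
    dist p X + dist X Y ≤ pathLength p l ∨ dist p Y + dist Y X ≤ pathLength p l := by
  induction l generalizing p with
  | nil => simp at hX
  | cons Z l ih =>
    rcases List.mem_cons.1 hX with rfl | hX'
    · rcases List.mem_cons.1 hY with rfl | hY'
      · left
        rw [dist_self, add_zero]
        exact dist_le_pathLength hX p
      · exact Or.inl (add_le_add le_rfl (dist_le_pathLength hY' _))
    · rcases List.mem_cons.1 hY with rfl | hY'
      · exact Or.inr (add_le_add le_rfl (dist_le_pathLength hX' _))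
      · have h1 := dist_triangle p Z X
        have h2 := dist_triangle p Z Y
        simp only [pathLength]
        rcases ih hX' hY' Z with h | h
        · left; linarith
        · right; linarith

/-- Neither of two points sees everything the other one sees. -/
def Incomparable (X Y : Plane) : Prop :=
  ¬ visibleArc X ⊆ visibleArc Y ∧ ¬ visibleArc Y ⊆ visibleArc X

theorem exists_isChain_cons (X : Plane) {l : List Plane} (hl : l.IsChain Incomparable) :
    ∃ l' : List Plane, l'.IsChain Incomparable ∧ visibleUnion l' = visibleUnion (X :: l) ∧
      ∀ p, pathLength p l' ≤ pathLength p (X :: l) := by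
  induction l with
  | nil => exact ⟨[X], List.isChain_singleton X, rfl, fun p => le_rfl⟩
  | cons Y l ih =>
    by_cases h1 : visibleArc X ⊆ visibleArc Y
    · refine ⟨Y :: l, hl, ?_, fun p => ?_⟩
      · rw [visibleUnion_cons X, visibleUnion_cons Y, ← Set.union_assoc, Set.union_eq_right.2 h1]
      · exact pathLength_le_dist_add p X (Y :: l)
    by_cases h2 : visibleArc Y ⊆ visibleArc X
    · obtain ⟨l', h3, h4, h5⟩ := ih hl.tail
      refine ⟨l', h3, ?_, fun p => (h5 p).trans ?_⟩
      · rw [h4, visibleUnion_cons X, visibleUnion_cons X, visibleUnion_cons Y, ← Set.union_assoc,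
          Set.union_eq_left.2 h2]
      · exact add_le_add le_rfl (pathLength_le_dist_add X Y l)
    · exact ⟨X :: Y :: l, hl.cons_cons ⟨h1, h2⟩, rfl, fun p => le_rfl⟩

/-- Dropping a point whose arc lies in a neighbour's arc keeps the visible set and, by the triangle
inequality, does not lengthen the path. The incomparability left over supplies the hypotheses of
`exitCost_step` and `volume_real_closedBall_diff_le`. -/
theorem exists_isChain (l : List Plane) :
    ∃ l' : List Plane, l'.IsChain Incomparable ∧ visibleUnion l' = visibleUnion l ∧
      ∀ p, pathLength p l' ≤ pathLength p l := by
  induction l with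
  | nil => exact ⟨[], List.isChain_nil, rfl, fun p => le_rfl⟩
  | cons X l ih =>
    obtain ⟨l₁, h1, h2, h3⟩ := ih
    obtain ⟨l₂, h4, h5, h6⟩ := exists_isChain_cons X h1
    refine ⟨l₂, h4, ?_, fun p => (h6 p).trans (add_le_add le_rfl (h3 X))⟩
    rw [h5, visibleUnion_cons, visibleUnion_cons, h2]

/-! ### Path length against the measure of the visible set. -/

theorem exitCost_le_pathLength {l : List Plane} {φ α : ℝ} (h0 : 0 ≤ α) (h1 : α < π / 2)
    (hl : (polarPoint φ α :: l).IsChain Incomparable) :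
    exitCost (tan α)
        ((volume : Measure Angle).real (visibleUnion l \ visibleArc (polarPoint φ α)))
      ≤ pathLength (polarPoint φ α) l := by
  induction l generalizing φ α with
  | nil => simp [visibleUnion_nil, exitCost_zero, pathLength]
  | cons Y l ih =>
    have hXY : Incomparable (polarPoint φ α) Y := by
      cases hl with | cons_cons h _ => exact h
    have hne : (visibleArc Y).Nonempty := by
      by_contra h
      rw [Set.not_nonempty_iff_eq_empty] at h
      exact hXY.2 (h ▸ Set.empty_subset _)
    obtain ⟨ψ, β, h2, h3, rfl⟩ := exists_eq_polarPoint hne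
    have hcα : 0 < cos α := cos_pos_of_mem_Ioo ⟨by linarith, h1⟩
    have hcβ : 0 < cos β := cos_pos_of_mem_Ioo ⟨by linarith, h3⟩
    rw [Incomparable, visibleArc_polarPoint h0 h1, visibleArc_polarPoint h2 h3] at hXY
    have h4 : α ≤ dist (ψ : Angle) φ + β := by
      by_contra h
      exact hXY.2 (closedBall_subset_closedBall' (by linarith))
    have h5 : β ≤ dist (ψ : Angle) φ + α := by
      by_contra h
      exact hXY.1 (closedBall_subset_closedBall' (by rw [dist_comm]; linarith))
    have h6 := volume_real_closedBall_diff_le h2 h4 h5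
    have h7 := ih h2 h3 hl.tail
    set m := (volume : Measure Angle).real (visibleUnion l \ visibleArc (polarPoint ψ β)) with hm
    have h8 : (volume : Measure Angle).real
        (visibleUnion (polarPoint ψ β :: l) \ visibleArc (polarPoint φ α))
        ≤ m + min (dist (ψ : Angle) φ + β - α) (2 * β) := by
      refine le_trans ?_ (add_le_add le_rfl h6)
      refine le_trans (measureReal_mono (s₂ := (visibleUnion l \ visibleArc (polarPoint ψ β)) ∪
        (closedBall (ψ : Angle) β \ closedBall (φ : Angle) α)) ?_) (measureReal_union_le _ _)
      rw [visibleUnion_cons, visibleArc_polarPoint h0 h1, visibleArc_polarPoint h2 h3]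
      rintro θ ⟨h | h, h'⟩
      · exact Or.inr ⟨h, h'⟩
      · by_cases h'' : θ ∈ closedBall (ψ : Angle) β
        · exact Or.inr ⟨h'', h'⟩
        · exact Or.inl ⟨h, h''⟩
    have h9 := exitCost_step (m := m) h0 h1 h2 h3 h4
      (by rw [dist_eq_norm]; exact norm_angle_le_pi _)
    rw [← dist_polarPoint hcα hcβ] at h9
    have h10 := exitCost_mono (tan_nonneg_of_nonneg_of_le_pi_div_two h0 h1.le)
      measureReal_nonneg h8
    simp only [pathLength]
    linarith

theorem exists_exitCost_le_pathLength {l : List Plane} {θ : ℝ} (hθ : π ≤ θ)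
    (h : θ ≤ (volume : Measure Angle).real (visibleUnion l)) :
    ∃ β, 0 ≤ β ∧ β < π / 2 ∧ 1 / cos β + exitCost (tan β) (θ - 2 * β) ≤ pathLength 0 l := by
  obtain ⟨l', h1, h2, h3⟩ := exists_isChain l
  rw [← h2] at h
  cases l' with
  | nil =>
    rw [visibleUnion_nil, measureReal_empty] at h
    linarith [pi_pos]
  | cons Y l' =>
    have hne : (visibleArc Y).Nonempty := by
      by_contra h'
      rw [Set.not_nonempty_iff_eq_empty] at h'
      -- A point that sees nothing is comparable with any successor, so it would be the only point
      -- of the chain.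
      cases l' with
      | nil =>
        rw [visibleUnion_cons, visibleUnion_nil, h', Set.union_empty, measureReal_empty] at h
        linarith [pi_pos]
      | cons Z l' =>
        cases h1 with | cons_cons h'' _ => exact h''.1 (h' ▸ Set.empty_subset _)
    obtain ⟨φ, β, h4, h5, rfl⟩ := exists_eq_polarPoint hne
    refine ⟨β, h4, h5, le_trans ?_ (h3 0)⟩
    have hcβ : 0 < cos β := cos_pos_of_mem_Ioo ⟨by linarith, h5⟩
    have h6 := exitCost_le_pathLength h4 h5 h1
    have h7 : θ - 2 * β ≤
        (volume : Measure Angle).real (visibleUnion l' \ visibleArc (polarPoint φ β)) := by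
      rw [visibleUnion_cons, ← Set.union_sdiff_self] at h
      have h8 := measureReal_union_le (μ := (volume : Measure Angle)) (visibleArc (polarPoint φ β))
        (visibleUnion l' \ visibleArc (polarPoint φ β))
      have h9 := volume_real_angle_closedBall_le φ h4
      rw [← visibleArc_polarPoint h4 h5] at h9
      linarith
    have h8 := exitCost_mono (tan_nonneg_of_nonneg_of_le_pi_div_two h4 h5.le)
      (by linarith) h7
    simp only [pathLength]
    rw [dist_zero_left, norm_polarPoint hcβ]
    linarith

/-- In the long regime the bound is `sqrt_three_sub_le`. The short regime forces `θ = π` and `β ≥ π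
/ 4`; there the exit costs exactly 2, and `2 + √2` exceeds the target numerically. -/
theorem one_or_two_agents_cost_le {β θ : ℝ} (h0 : 0 ≤ β) (h1 : β < π / 2)
    (hθ : θ = 2 * π ∨ θ = π) :
    1 + √3 + θ - 5 * π / 6 ≤ 1 / cos β + exitCost (tan β) (θ - 2 * β) := by
  have hpi := pi_pos
  by_cases h : θ - 2 * β ≤ π / 2
  · obtain rfl : θ = π := by
      rcases hθ with rfl | rfl
      · linarith
      · rfl
    have hcβ : 0 < cos β := cos_pos_of_mem_Ioo ⟨by linarith, h1⟩
    rw [exitCost, if_pos h, cos_pi_sub, sin_pi_sub]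
    have e : 1 - -cos (2 * β) + tan β * sin (2 * β) = 2 := by
      rw [tan_eq_sin_div_cos, sin_two_mul, cos_two_mul]
      field_simp
      linear_combination 2 * sin_sq_add_cos_sq β
    have h2 : cos β ≤ √2 / 2 := by
      rw [← cos_pi_div_four]
      exact cos_le_cos_of_nonneg_of_le_pi (by linarith) (by linarith) (by linarith)
    have h3 : √2 ≤ 1 / cos β := by
      rw [le_div_iff₀ hcβ]
      nlinarith [mul_self_sqrt (show (0 : ℝ) ≤ 2 by norm_num), sqrt_nonneg 2]
    have h4 : 1.414 ≤ √2 := le_sqrt_of_sq_le (by norm_num)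
    have h5 : √3 ≤ 1.7321 := by rw [sqrt_le_left (by norm_num)]; norm_num
    have h6 := pi_lt_d2
    linarith
  · rw [exitCost, if_neg h]
    linarith [sqrt_three_sub_le h0 h1]

/-! ### Inspection as a half-plane condition, and discretisation of trajectories. -/

/-- The point of the unit circle in direction `θ`. -/
def circlePoint (θ : ℝ) : Plane :=
  !₂[cos θ, sin θ]

theorem inner_circlePoint (Y : Plane) (θ : ℝ) :
    inner ℝ Y (circlePoint θ) = Y 0 * cos θ + Y 1 * sin θ := by
  simp [circlePoint, PiLp.inner_apply, Fin.sum_univ_two, mul_comm]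

theorem inner_circlePoint_circlePoint (φ θ : ℝ) :
    inner ℝ (circlePoint φ) (circlePoint θ) = cos (φ - θ) := by
  rw [inner_circlePoint, cos_sub]
  simp [circlePoint]

theorem norm_circlePoint (θ : ℝ) : ‖circlePoint θ‖ = 1 := by
  rw [EuclideanSpace.norm_eq, Fin.sum_univ_two]
  simp [circlePoint]

theorem mem_sphere_iff_exists_circlePoint {P : Plane} :
    P ∈ sphere (0 : Plane) 1 ↔ ∃ θ, P = circlePoint θ := by
  constructor
  · intro h
    rw [mem_sphere_zero_iff_norm, EuclideanSpace.norm_eq, Fin.sum_univ_two, sqrt_eq_one] at h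
    simp only [norm_eq_abs, sq_abs] at h
    have hz : ‖(⟨P 0, P 1⟩ : ℂ)‖ = 1 := by
      rw [← sq_eq_sq₀ (norm_nonneg _) zero_le_one, Complex.sq_norm, Complex.normSq_apply]
      linarith
    have e1 := Complex.norm_mul_cos_arg ⟨P 0, P 1⟩
    have e2 := Complex.norm_mul_sin_arg ⟨P 0, P 1⟩
    rw [hz, one_mul] at e1 e2
    refine ⟨Complex.arg ⟨P 0, P 1⟩, ?_⟩
    ext i
    fin_cases i
    · exact e1.symm
    · exact e2.symm
  · rintro ⟨θ, rfl⟩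
    rw [mem_sphere_zero_iff_norm, norm_circlePoint]

theorem inspects_iff {A P : Plane} (hP : ‖P‖ = 1) : Inspects A P ↔ 1 ≤ inner ℝ A P := by
  have hPP : inner ℝ P P = (1 : ℝ) := by rw [real_inner_self_eq_norm_sq, hP, one_pow]
  have key : ∀ s : ℝ, ‖s • A + (1 - s) • P‖ ^ 2
      = 1 + 2 * s * (inner ℝ A P - 1) + s ^ 2 * (‖A‖ ^ 2 - 2 * inner ℝ A P + 1) := by
    intro s
    rw [norm_add_sq_real, norm_smul, norm_smul, inner_smul_left, inner_smul_right, hP,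
      mul_pow, mul_pow, norm_eq_abs, norm_eq_abs, sq_abs, sq_abs]
    simp only [conj_trivial]
    ring
  have hq : 0 ≤ ‖A‖ ^ 2 - 2 * inner ℝ A P + 1 := by
    have := sq_nonneg ‖A - P‖
    rw [norm_sub_sq_real, hP] at this
    linarith
  constructor
  · intro h
    by_contra! hlt
    set q := ‖A‖ ^ 2 - 2 * inner ℝ A P + 1 with hqdef
    set e := 1 - inner ℝ A P with he
    have he0 : 0 < e := by linarith
    -- The squared norm on the segment is `1 - 2 * s * e + s ^ 2 * q`; this `s` stays in `(0, 1]`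
    -- and satisfies `s * q < 2 * e`, so the norm drops below 1.
    set s := e / (e + q) with hs
    have hs0 : 0 < s := by positivity
    have hs1 : s ≤ 1 := by rw [hs, div_le_one (by positivity)]; linarith
    have hseg : s • A + (1 - s) • P ∈ segment ℝ A P :=
      ⟨s, 1 - s, hs0.le, by linarith, by ring, rfl⟩
    refine Set.disjoint_left.1 h hseg ?_
    rw [mem_ball_zero_iff, ← sq_lt_sq₀ (norm_nonneg _) zero_le_one, key]
    have h2 : s * (e + q) = e := by rw [hs]; field_simp
    have h3 : s * q < 2 * e := by nlinarith
    have h4 : s * (s * q) < s * (2 * e) := mul_lt_mul_of_pos_left h3 hs0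
    have h5 : inner ℝ A P - 1 = -e := by rw [he]; ring
    rw [h5]
    nlinarith
  · intro h
    refine Set.disjoint_left.2 ?_
    rintro X ⟨s, t, hs, ht, hst, rfl⟩ hX
    obtain rfl : t = 1 - s := by linarith
    rw [mem_ball_zero_iff, ← sq_lt_sq₀ (norm_nonneg _) zero_le_one, key] at hX
    have : 0 ≤ 2 * s * (inner ℝ A P - 1) := mul_nonneg (by linarith) (by linarith)
    have : 0 ≤ s ^ 2 * (‖A‖ ^ 2 - 2 * inner ℝ A P + 1) := by positivity
    linarith

theorem coe_mem_visibleArc {Y : Plane} {θ : ℝ} :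
    (θ : Angle) ∈ visibleArc Y ↔ 1 ≤ inner ℝ Y (circlePoint θ) := by
  rw [inner_circlePoint]; rfl

theorem IsTrajectory.dist_le {γ : ℝ → Plane} (h : IsTrajectory γ) {s t : ℝ} (hs : 0 ≤ s)
    (hst : s ≤ t) : dist (γ s) (γ t) ≤ t - s := by
  have h1 := h.unitSpeed (x := s) hs (y := t) (hs.trans hst)
  have h2 := eVariationOn.edist_le γ (s := Set.Ici 0 ∩ Set.Icc s t)
    (x := s) (y := t) ⟨hs, le_rfl, hst⟩ ⟨hs.trans hst, hst, le_rfl⟩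
  rw [h1, NNReal.coe_one, one_mul, edist_dist,
    ENNReal.ofReal_le_ofReal_iff (by linarith)] at h2
  exact h2

theorem pathLength_map_range'_le {f : ℕ → Plane} {κ : ℝ}
    (hf : ∀ j, dist (f j) (f (j + 1)) ≤ κ) (a k : ℕ) :
    pathLength (f a) ((List.range' (a + 1) k).map f) ≤ k * κ := by
  induction k generalizing a with
  | zero => simp [pathLength]
  | succ k ih =>
    rw [List.range'_succ, List.map_cons, pathLength]
    have := hf a
    have := ih (a + 1)
    push_cast
    linarith

/-- Sampling every `κ` time units moves a position by at most `κ`, so its inner product with an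
inspected point may fall to `1 - κ`; dilation by `(1 - κ)⁻¹` repairs this. The slack between the
cost and `v` absorbs the longer path. -/
theorem exists_lists_of_worstCaseTime_lt {n : ℕ} {γ : Fin n → ℝ → Plane}
    (hγ : ∀ i, IsTrajectory (γ i)) {v : ℝ} (hv : worstCaseTime γ < ENNReal.ofReal v) :
    ∃ ls : Fin n → List Plane, (∀ θ, ∃ i, θ ∈ visibleUnion (ls i)) ∧
      ∀ i, pathLength 0 (ls i) < v := by
  obtain ⟨c, hc0, hc1, hc2⟩ := ENNReal.lt_iff_exists_real_btwn.1 hv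
  have hv0 : 0 < v := by
    by_contra h
    rw [ENNReal.ofReal_of_nonpos (not_lt.1 h)] at hv
    simp at hv
  have hcv : c < v := (ENNReal.ofReal_lt_ofReal_iff hv0).1 hc2
  have hvis : ∀ θ : ℝ, ∃ i t, 0 ≤ t ∧ t < c ∧ 1 ≤ inner ℝ (γ i t) (circlePoint θ) := by
    intro θ
    have h1 : inspectionTime γ (circlePoint θ) < ENNReal.ofReal c :=
      lt_of_le_of_lt (le_iSup₂ (f := fun P _ => inspectionTime γ P) (circlePoint θ)
        (mem_sphere_iff_exists_circlePoint.2 ⟨θ, rfl⟩)) hc1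
    simp only [inspectionTime, iInf_lt_iff] at h1
    obtain ⟨i, t, ⟨ht, hins⟩, hlt⟩ := h1
    exact ⟨i, t, ht, (ENNReal.ofReal_lt_ofReal_iff_of_nonneg ht).1 hlt,
      (inspects_iff (norm_circlePoint θ)).1 hins⟩
  have hcpos : 0 < c := by
    obtain ⟨_, t, h1, h2, _⟩ := hvis 0
    exact h1.trans_lt h2
  -- This `N` makes `c / (1 - κ) < v` for `κ = c / N`.
  obtain ⟨N, hN⟩ := exists_nat_gt (c * v / (v - c))
  have hvc : 0 < v - c := by linarith
  have hN0 : (0 : ℝ) < N := lt_trans (by positivity) hN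
  set κ : ℝ := c / N with hκ
  have hκ0 : 0 < κ := by positivity
  have hNκ : N * κ = c := by rw [hκ]; field_simp
  have hκv : κ * v < v - c := by
    rw [div_lt_iff₀ hvc] at hN
    rw [hκ, div_mul_eq_mul_div, div_lt_iff₀ hN0]
    linarith
  have hκ1 : 0 < 1 - κ := by nlinarith
  set f : Fin n → ℕ → Plane := fun i j => (1 - κ)⁻¹ • γ i (j * κ) with hf
  have hstep : ∀ i j, dist (f i j) (f i (j + 1)) ≤ (1 - κ)⁻¹ * κ := by
    intro i j
    rw [hf, dist_smul₀, norm_eq_abs, abs_of_pos (by positivity)]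
    gcongr
    refine ((hγ i).dist_le (by positivity) ?_).trans ?_
    · push_cast; nlinarith
    · push_cast; linarith
  refine ⟨fun i => (List.range' 1 N).map (f i), fun θ => ?_, fun i => ?_⟩
  · induction θ using Angle.induction_on with
    | _ x =>
    obtain ⟨i, t, ht0, htc, hin⟩ := hvis x
    have htpos : 0 < t := by
      rcases ht0.eq_or_lt with rfl | h
      · rw [(hγ i).start, inner_zero_left] at hin
        linarith
      · exact h
    set j := ⌈t / κ⌉₊ with hj
    have hj0 : 0 < j := Nat.ceil_pos.2 (by positivity)
    have hjN : j ≤ N := by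
      rw [hj, Nat.ceil_le, div_le_iff₀ hκ0, hNκ]
      exact htc.le
    have hj1 : t ≤ j * κ := by
      rw [← div_le_iff₀ hκ0]; exact Nat.le_ceil _
    have hj2 : j * κ - t ≤ κ := by
      have := (Nat.ceil_lt_add_one (show 0 ≤ t / κ by positivity)).le
      rw [← hj, ← sub_le_iff_le_add, le_div_iff₀ hκ0] at this
      linarith
    refine ⟨i, f i j, List.mem_map.2 ⟨j, ?_, rfl⟩, ?_⟩
    · rw [List.mem_range'_1]; omega
    · rw [coe_mem_visibleArc, hf, real_inner_smul_left, ← div_eq_inv_mul, le_div_iff₀ hκ1, one_mul]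
      have h1 : inner ℝ (γ i t - γ i (j * κ)) (circlePoint x) ≤ κ := by
        refine (real_inner_le_norm _ _).trans ?_
        rw [norm_circlePoint, mul_one, ← dist_eq_norm]
        exact ((hγ i).dist_le ht0 hj1).trans hj2
      rw [inner_sub_left] at h1
      linarith
  · have h1 := pathLength_map_range'_le (hstep i) 0 N
    have h2 : f i 0 = 0 := by simp [hf, (hγ i).start]
    rw [h2, zero_add] at h1
    refine h1.trans_lt ?_
    rw [mul_left_comm, hNκ, ← div_eq_inv_mul, div_lt_iff₀ hκ1]
    linarith

/-! ### Lower bound for three or more agents. -/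

/-- Adding the two inspection conditions gives `2 ≤ inner ℝ X (P + Q) + inner ℝ (Y - X) Q ≤ 2 * q *
‖X‖ + ‖Y - X‖`. The last term is at most `2 * q * ‖Y - X‖` because `q ≥ 1 / 2`, which for `q = cos
(π / n)` is where `n ≥ 3` enters. -/
theorem one_div_le_dist_add_dist {X Y : Plane} {θ η q : ℝ} (hq : 1 / 2 ≤ q)
    (h : cos (θ - η) ≤ 2 * q ^ 2 - 1) (hX : 1 ≤ inner ℝ X (circlePoint θ))
    (hY : 1 ≤ inner ℝ Y (circlePoint η)) : 1 / q ≤ dist 0 X + dist X Y := by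
  have hq0 : 0 < q := by linarith
  set P := circlePoint θ
  set Q := circlePoint η
  have h1 : ‖P + Q‖ ≤ 2 * q := by
    rw [← sq_le_sq₀ (norm_nonneg _) (by positivity), norm_add_sq_real, norm_circlePoint,
      norm_circlePoint, inner_circlePoint_circlePoint]
    linarith
  have h2 : inner ℝ X (P + Q) ≤ ‖X‖ * (2 * q) :=
    (real_inner_le_norm _ _).trans (by gcongr)
  have h3 : inner ℝ (Y - X) Q ≤ ‖Y - X‖ := by
    refine (real_inner_le_norm _ _).trans ?_
    rw [norm_circlePoint, mul_one]
  rw [inner_add_right] at h2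
  rw [inner_sub_left] at h3
  rw [dist_zero_left, dist_comm, dist_eq_norm, div_le_iff₀ hq0]
  nlinarith [norm_nonneg (Y - X)]

theorem one_div_le_pathLength {l : List Plane} {θ η q : ℝ} (hq : 1 / 2 ≤ q)
    (h : cos (θ - η) ≤ 2 * q ^ 2 - 1) (hθ : (θ : Angle) ∈ visibleUnion l)
    (hη : (η : Angle) ∈ visibleUnion l) : 1 / q ≤ pathLength 0 l := by
  obtain ⟨X, hX, hX'⟩ := hθ
  obtain ⟨Y, hY, hY'⟩ := hη
  rw [coe_mem_visibleArc] at hX' hY'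
  rcases two_dist_le_pathLength hX hY 0 with h' | h'
  · exact (one_div_le_dist_add_dist hq h hX' hY').trans h'
  · exact (one_div_le_dist_add_dist hq (by rwa [← cos_neg, neg_sub]) hY' hX').trans h'

theorem cos_two_pi_mul_div_le {n k : ℕ} (hk : 0 < k) (hkn : k < n) :
    cos (2 * π * k / n) ≤ cos (2 * π / n) := by
  have hpi := pi_pos
  have hn : (0 : ℝ) < n := by exact_mod_cast hk.trans hkn
  have hk1 : (1 : ℝ) ≤ k := by exact_mod_cast hk
  have hk2 : (k : ℝ) + 1 ≤ n := by exact_mod_cast hkn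
  have h1 : 2 * π / n ≤ 2 * π * k / n :=
    div_le_div_of_nonneg_right (by nlinarith) hn.le
  have h2 : 2 * π * k / n + 2 * π / n ≤ 2 * π := by
    rw [← add_div, div_le_iff₀ hn]; nlinarith
  have h0 : 0 < 2 * π / n := by positivity
  rcases le_total (2 * π * k / n) π with h | h
  · exact cos_le_cos_of_nonneg_of_le_pi h0.le h h1
  · rw [← cos_two_pi_sub]
    exact cos_le_cos_of_nonneg_of_le_pi h0.le (by linarith) (by linarith)

theorem cos_regular_polygon_le {n : ℕ} {j k : Fin n} (h : j ≠ k) (s : ℝ) :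
    cos ((s + 2 * π * j / n) - (s + 2 * π * k / n)) ≤ cos (2 * π / n) := by
  wlog hjk : k < j generalizing j k
  · rw [← cos_neg, neg_sub]
    exact this h.symm (lt_of_le_of_ne (not_lt.1 hjk) h)
  have h1 : (k : ℕ) < j := hjk
  rw [show (s + 2 * π * j / n) - (s + 2 * π * k / n) = 2 * π * ((j - k : ℕ) : ℝ) / n by
    rw [Nat.cast_sub h1.le]; ring]
  exact cos_two_pi_mul_div_le (by omega) (by omega)

theorem exists_one_div_cos_le_pathLength {n : ℕ} (hn : 3 ≤ n) {ls : Fin n → List Plane}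
    (h : ∀ θ, ∃ i, θ ∈ visibleUnion (ls i)) : ∃ i, 1 / cos (π / n) ≤ pathLength 0 (ls i) := by
  by_contra! hlt
  have hpi := pi_pos
  have hn' : (3 : ℝ) ≤ n := by exact_mod_cast hn
  have hq : 1 / 2 ≤ cos (π / n) := by
    rw [← cos_pi_div_three]
    exact cos_le_cos_of_nonneg_of_le_pi (by positivity) (by linarith) (by gcongr)
  have hq2 : 2 * cos (π / n) ^ 2 - 1 = cos (2 * π / n) := by
    rw [mul_div_assoc, cos_two_mul]
  have sep : ∀ {i : Fin n} {θ η : ℝ}, (θ : Angle) ∈ visibleUnion (ls i) →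
      (η : Angle) ∈ visibleUnion (ls i) → cos (2 * π / n) < cos (θ - η) := by
    intro i θ η h1 h2
    by_contra! h3
    rw [← hq2] at h3
    exact absurd (one_div_le_pathLength hq h3 h1 h2) (not_le.2 (hlt i))
  -- Each agent inspects exactly one vertex of every inscribed regular `n`-gon.
  have uniq : ∀ (s : ℝ) (i i' : Fin n), (s : Angle) ∈ visibleUnion (ls i) →
      (s : Angle) ∈ visibleUnion (ls i') → i = i' := by
    intro s i i' h1 h2
    have hpos : 0 < n := by omega
    have e0 : ((s + 2 * π * ((⟨0, hpos⟩ : Fin n) : ℕ) / n : ℝ) : Angle) = (s : Angle) := by simp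
    have key : ∀ i₀, (s : Angle) ∈ visibleUnion (ls i₀) → ∃ g : Fin n → Fin n,
        (∀ k : Fin n, ((s + 2 * π * k / n : ℝ) : Angle) ∈ visibleUnion (ls (g k))) ∧
          g ⟨0, hpos⟩ = i₀ := by
      intro i₀ h3
      choose g hg using fun k : Fin n => h ((s + 2 * π * k / n : ℝ) : Angle)
      -- Vertex 0 may be assigned to any agent that sees it. The assignment is injective, hence
      -- surjective, so a second agent seeing vertex 0 would also see another vertex.
      refine ⟨Function.update g ⟨0, hpos⟩ i₀, fun k => ?_, by simp⟩
      by_cases hk : k = ⟨0, hpos⟩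
      · subst hk
        rw [e0]; simpa using h3
      · simpa [hk] using hg k
    have inj : ∀ g : Fin n → Fin n,
        (∀ k : Fin n, ((s + 2 * π * k / n : ℝ) : Angle) ∈ visibleUnion (ls (g k))) →
          Function.Injective g := by
      intro g hg j k hjk
      by_contra hne
      have h4 := hg j
      rw [hjk] at h4
      exact absurd (sep h4 (hg k)) (not_lt.2 (cos_regular_polygon_le hne s))
    obtain ⟨g, hg, hg0⟩ := key i h1
    obtain ⟨k, hk⟩ := Finite.surjective_of_injective (inj g hg) i'
    have h5 := hg k
    rw [hk] at h5
    by_contra hne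
    have hk0 : (⟨0, hpos⟩ : Fin n) ≠ k := by
      rintro rfl
      exact hne (hg0.symm.trans hk)
    have h6 := cos_regular_polygon_le hk0 s
    rw [← e0] at h2
    exact absurd (sep h2 h5) (not_lt.2 h6)
  let A : Fin n → Set ℝ := fun i => {s | (s : Angle) ∈ visibleUnion (ls i)}
  have hA : ∀ i, IsClosed (A i) := fun i =>
    (isClosed_visibleUnion (ls i)).preimage Angle.continuous_coe
  obtain ⟨i, hi⟩ := h ((0 : ℝ) : Angle)
  have hcompl : (A i)ᶜ = ⋃ j ∈ {j | j ≠ i}, A j := by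
    ext s
    simp only [Set.mem_compl_iff, Set.mem_iUnion, exists_prop]
    constructor
    · intro hs
      obtain ⟨j, hj⟩ := h (s : Angle)
      exact ⟨j, fun e => hs (e ▸ hj), hj⟩
    · rintro ⟨j, hji, hj⟩ hs
      exact hji (uniq s j i hj hs)
  have hopen : IsOpen (A i) := by
    rw [← isClosed_compl_iff, hcompl]
    exact (Set.toFinite _).isClosed_biUnion fun j _ => hA j
  have huniv : A i = Set.univ := IsClopen.eq_univ ⟨hA i, hopen⟩ ⟨0, hi⟩
  -- One agent now sees two antipodal points, whose angular cosine is the minimum `-1`.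
  have hpi' : π ∈ A i := huniv ▸ Set.mem_univ _
  have := sep hpi' hi
  rw [sub_zero, cos_pi] at this
  linarith [neg_one_le_cos (2 * π / n)]

/-! ### Lower bound for one or two agents, and transfer to trajectories. -/

theorem exists_cost_le_pathLength {n : ℕ} (hn : n = 1 ∨ n = 2) {ls : Fin n → List Plane}
    (h : ∀ θ, ∃ i, θ ∈ visibleUnion (ls i)) :
    ∃ i, 1 + √3 + 2 * π / n - 5 * π / 6 ≤ pathLength 0 (ls i) := by
  have hpi := pi_pos
  have hθ : 2 * π / n = 2 * π ∨ 2 * π / n = π := by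
    rcases hn with rfl | rfl
    · left; simp
    · right; norm_num
  have hn0 : (0 : ℝ) < n := by rcases hn with rfl | rfl <;> norm_num
  obtain ⟨i, hi⟩ : ∃ i, 2 * π / n ≤ (volume : Measure Angle).real (visibleUnion (ls i)) := by
    by_contra! hlt
    have h1 : (⋃ i, visibleUnion (ls i)) = Set.univ :=
      Set.eq_univ_of_forall fun θ => Set.mem_iUnion.2 (h θ)
    have h2 := measureReal_iUnion_fintype_le (μ := (volume : Measure Angle))
      fun i => visibleUnion (ls i)
    rw [h1, volume_real_angle_univ] at h2
    have : Nonempty (Fin n) := (h 0).nonempty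
    have h3 := Finset.sum_lt_sum_of_nonempty Finset.univ_nonempty fun i (_ : i ∈ Finset.univ) =>
      hlt i
    rw [Finset.sum_const, Finset.card_univ, Fintype.card_fin, nsmul_eq_mul,
      mul_div_cancel₀ _ hn0.ne'] at h3
    linarith
  obtain ⟨β, h0, h1, h2⟩ :=
    exists_exitCost_le_pathLength (by rcases hθ with h | h <;> linarith) hi
  exact ⟨i, (one_or_two_agents_cost_le h0 h1 hθ).trans h2⟩

theorem ofReal_le_worstCaseTime {n : ℕ} {γ : Fin n → ℝ → Plane} (hγ : IsFeasible γ) {v : ℝ}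
    (hv : ∀ ls : Fin n → List Plane, (∀ θ, ∃ i, θ ∈ visibleUnion (ls i)) →
      ∃ i, v ≤ pathLength 0 (ls i)) : ENNReal.ofReal v ≤ worstCaseTime γ := by
  by_contra! h
  obtain ⟨ls, h1, h2⟩ := exists_lists_of_worstCaseTime_lt hγ.trajectory h
  obtain ⟨i, hi⟩ := hv ls h1
  exact absurd hi (not_le.2 (h2 i))

/-! ### Unit-speed criteria for lines and circular arcs. -/

/-- The Lipschitz bound caps the variation. Conversely, `N` equal steps lose only `(y - x) ^ 2 / N`
in total, which tends to 0. -/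
theorem hasUnitSpeedOn_of_dist_bounds {E : Type*} [PseudoMetricSpace E] {f : ℝ → E} {s : Set ℝ}
    [hs : s.OrdConnected]
    (hle : ∀ x ∈ s, ∀ y ∈ s, x ≤ y → dist (f x) (f y) ≤ y - x)
    (hge : ∀ x ∈ s, ∀ y ∈ s, x ≤ y → y - x ≤ 1 → y - x - (y - x) ^ 2 ≤ dist (f x) (f y)) :
    HasUnitSpeedOn f s := by
  rw [HasUnitSpeedOn, hasConstantSpeedOnWith_iff_ordered]
  intro x hx y hy hxy
  have hsub : Set.Icc x y ⊆ s := hs.out hx hy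
  rw [Set.inter_eq_right.2 hsub, NNReal.coe_one, one_mul]
  apply le_antisymm
  · have hlip : LipschitzOnWith 1 f (Set.Icc x y) := by
      refine LipschitzOnWith.of_dist_le_mul fun u hu w hw => ?_
      rw [NNReal.coe_one, one_mul]
      rcases le_total u w with h | h
      · rw [Real.dist_eq, abs_sub_comm, abs_of_nonneg (by linarith)]
        exact hle u (hsub hu) w (hsub hw) h
      · rw [Real.dist_eq, abs_of_nonneg (by linarith), dist_comm]
        exact hle w (hsub hw) u (hsub hu) h
    have h1 := hlip.comp_eVariationOn_le (g := id) (s := Set.Icc x y) (Set.mapsTo_id _)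
    have h2 := MonotoneOn.eVariationOn_eq (f := (id : ℝ → ℝ)) (s := Set.Icc x y)
      (monotone_id.monotoneOn _) (a := x) (b := y) ⟨le_rfl, hxy⟩ ⟨hxy, le_rfl⟩
    rw [Set.inter_self] at h2
    rw [h2, ENNReal.coe_one, one_mul] at h1
    exact h1
  · have key : ∀ N : ℕ, y - x < N →
        ENNReal.ofReal (y - x - (y - x) ^ 2 / N) ≤ eVariationOn f (Set.Icc x y) := by
      intro N hN
      have hN0 : (0 : ℝ) < N := by linarith
      set h := (y - x) / N with hh
      have hh0 : 0 ≤ h := div_nonneg (by linarith) hN0.le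
      have hh1 : h ≤ 1 := by rw [hh, div_le_one hN0]; exact hN.le
      have hNh : N * h = y - x := by rw [hh]; field_simp
      have hmem : ∀ i ≤ N, x + i * h ∈ Set.Icc x y := by
        intro i hi
        have : (i : ℝ) ≤ N := by exact_mod_cast hi
        exact ⟨by nlinarith [show (0 : ℝ) ≤ i * h by positivity], by nlinarith⟩
      have hsum := eVariationOn.sum_le_of_monotoneOn_Icc (f := f) (s := Set.Icc x y) (m := 0)
        (n := N) (u := fun i => x + i * h)
        (fun i _ j _ hij => by
          have : (i : ℝ) ≤ j := by exact_mod_cast hij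
          change x + i * h ≤ x + j * h
          gcongr)
        (fun i hi => hmem i hi.2)
      refine le_trans ?_ hsum
      have hterm : ∀ i ∈ Finset.Ico 0 N, ENNReal.ofReal (h - h ^ 2) ≤
          edist (f (x + (i + 1 : ℕ) * h)) (f (x + i * h)) := by
        intro i hi
        have hi' : i + 1 ≤ N := (Finset.mem_Ico.1 hi).2
        rw [edist_comm, edist_dist]
        apply ENNReal.ofReal_le_ofReal
        have e : x + (i + 1 : ℕ) * h - (x + i * h) = h := by push_cast; ring
        have := hge _ (hsub (hmem i (by omega))) _ (hsub (hmem (i + 1) hi'))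
          (by linarith) (by linarith)
        rwa [e] at this
      refine le_trans ?_ (Finset.sum_le_sum hterm)
      rw [Finset.sum_const, Nat.card_Ico, Nat.sub_zero, nsmul_eq_mul, ← ENNReal.ofReal_natCast,
        ← ENNReal.ofReal_mul hN0.le]
      apply ENNReal.ofReal_le_ofReal
      rw [hh]
      apply le_of_eq
      field_simp
    have hlim : Filter.Tendsto (fun N : ℕ => ENNReal.ofReal (y - x - (y - x) ^ 2 / N))
        Filter.atTop (nhds (ENNReal.ofReal (y - x))) := by
      refine ENNReal.tendsto_ofReal ?_
      have := (tendsto_const_div_atTop_nhds_zero_nat ((y - x) ^ 2)).const_sub (y - x)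
      rwa [sub_zero] at this
    refine le_of_tendsto hlim ?_
    obtain ⟨N₀, hN₀⟩ := exists_nat_gt (y - x)
    filter_upwards [Filter.eventually_ge_atTop N₀] with N hN
    exact key N (hN₀.trans_le (by exact_mod_cast hN))

theorem hasUnitSpeedOn_of_eqOn_line {E : Type*} [NormedAddCommGroup E] [NormedSpace ℝ E]
    {f : ℝ → E} {s : Set ℝ} [s.OrdConnected] {p u : E} {a : ℝ} (hu : ‖u‖ = 1)
    (hf : ∀ t ∈ s, f t = p + (t - a) • u) : HasUnitSpeedOn f s := by
  have key : ∀ x ∈ s, ∀ y ∈ s, x ≤ y → dist (f x) (f y) = y - x := by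
    intro x hx y hy hxy
    rw [hf x hx, hf y hy, dist_add_left, dist_comm, dist_eq_norm, ← sub_smul, norm_smul, hu,
      mul_one, norm_eq_abs, abs_of_nonneg (by linarith)]
    ring
  refine hasUnitSpeedOn_of_dist_bounds (fun x hx y hy h => (key x hx y hy h).le)
    fun x hx y hy h _ => ?_
  rw [key x hx y hy h]
  linarith [sq_nonneg (y - x)]

theorem dist_circlePoint (φ θ : ℝ) :
    dist (circlePoint φ) (circlePoint θ) = |2 * sin ((θ - φ) / 2)| := by
  rw [← sqrt_sq_eq_abs, EuclideanSpace.dist_eq, Fin.sum_univ_two]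
  congr 1
  simp only [circlePoint, Matrix.cons_val_zero, Matrix.cons_val_one, Real.dist_eq, sq_abs]
  have h := cos_two_mul ((θ - φ) / 2)
  rw [mul_div_cancel₀ _ two_ne_zero, cos_sub] at h
  linear_combination (sin_sq_add_cos_sq θ) + (sin_sq_add_cos_sq φ) - 2 * h
    - 4 * sin_sq_add_cos_sq ((θ - φ) / 2)

theorem hasUnitSpeedOn_of_eqOn_circle {f : ℝ → Plane} {s : Set ℝ} [s.OrdConnected] {a : ℝ}
    (hf : ∀ t ∈ s, f t = circlePoint (a + t)) : HasUnitSpeedOn f s := by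
  have key : ∀ x ∈ s, ∀ y ∈ s, dist (f x) (f y) = |2 * sin ((y - x) / 2)| := by
    intro x hx y hy
    rw [hf x hx, hf y hy, dist_circlePoint, add_sub_add_left_eq_sub]
  refine hasUnitSpeedOn_of_dist_bounds (fun x hx y hy h => ?_) fun x hx y hy h h' => ?_
  · rw [key x hx y hy, abs_mul, abs_two]
    have := abs_sin_le_abs (x := (y - x) / 2)
    rw [abs_of_nonneg (show 0 ≤ (y - x) / 2 by linarith)] at this
    linarith
  · rw [key x hx y hy]
    refine le_trans ?_ (le_abs_self _)
    obtain ⟨z, hz⟩ : ∃ z, y - x = 2 * z := ⟨(y - x) / 2, by ring⟩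
    rw [hz, mul_div_cancel_left₀ _ two_ne_zero]
    have hz0 : 0 ≤ z := by linarith
    rcases hz0.eq_or_lt with rfl | hz0
    · simp
    · have := sin_gt_sub_cube hz0
      have : z ^ 3 ≤ z ^ 2 := pow_le_pow_of_le_one hz0.le (by linarith) (by norm_num)
      nlinarith [sq_nonneg z]

/-! ### Optimal trajectories and attainment of the bounds. -/

theorem exists_rotation {n : ℕ} (hn : 0 < n) (a θ : ℝ) :
    ∃ (i : Fin n) (ω : ℝ), a ≤ ω ∧ ω ≤ a + 2 * π / n ∧
      circlePoint θ = circlePoint (2 * π * i / n + ω) := by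
  have hpi := pi_pos
  have hn0 : (0 : ℝ) < n := by exact_mod_cast hn
  set w : ℝ := 2 * π / n with hw
  have hw0 : 0 < w := by positivity
  set m : ℤ := ⌊(θ - a) / w⌋ with hm
  have h1 : m * w ≤ θ - a := by rw [← le_div_iff₀ hw0]; exact Int.floor_le _
  have h2 : θ - a ≤ (m + 1) * w := by
    rw [← div_le_iff₀ hw0]; exact (Int.lt_floor_add_one _).le
  have hn' : (n : ℤ) ≠ 0 := by omega
  have h3 := Int.emod_nonneg m hn'
  have h4 := Int.emod_lt_of_pos m (show (0 : ℤ) < n by omega)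
  have h5 := Int.emod_add_mul_ediv m n
  obtain ⟨i, hi⟩ := Int.eq_ofNat_of_zero_le h3
  refine ⟨⟨i, by omega⟩, θ - m * w, by linarith, by linarith, ?_⟩
  have e : 2 * π * (i : ℝ) / n + (θ - m * w) = θ - (m / n : ℤ) * (2 * π) := by
    have h6 : (m : ℝ) = i + n * (m / n : ℤ) := by
      rw [hi] at h5
      exact_mod_cast h5.symm
    rw [h6, hw]
    field_simp
    ring
  simp only [e, circlePoint, cos_sub_int_mul_two_pi, sin_sub_int_mul_two_pi]

theorem isOptimalWorstCaseCost_of {n : ℕ} {v : ℝ} {γ : Fin n → ℝ → Plane}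
    (hγ : ∀ i, IsTrajectory (γ i))
    (hins : ∀ θ, ∃ i t, 0 ≤ t ∧ t ≤ v ∧ 1 ≤ inner ℝ (γ i t) (circlePoint θ))
    (hv : ∀ ls : Fin n → List Plane, (∀ θ, ∃ i, θ ∈ visibleUnion (ls i)) →
      ∃ i, v ≤ pathLength 0 (ls i)) : IsOptimalWorstCaseCost n (ENNReal.ofReal v) := by
  have hf : IsFeasible γ := by
    refine ⟨hγ, fun P hP => ?_⟩
    obtain ⟨θ, rfl⟩ := mem_sphere_iff_exists_circlePoint.1 hP
    obtain ⟨i, t, h0, _, h⟩ := hins θ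
    exact ⟨i, t, h0, (inspects_iff (norm_circlePoint θ)).2 h⟩
  refine ⟨⟨γ, hf, le_antisymm ?_ (ofReal_le_worstCaseTime hf hv)⟩, ?_⟩
  · refine iSup₂_le fun P hP => ?_
    obtain ⟨θ, rfl⟩ := mem_sphere_iff_exists_circlePoint.1 hP
    obtain ⟨i, t, h0, h1, h⟩ := hins θ
    refine (iInf₂_le_of_le i t (iInf_le_of_le ⟨h0, ?_⟩ le_rfl)).trans
      (ENNReal.ofReal_le_ofReal h1)
    exact (inspects_iff (norm_circlePoint θ)).2 h
  · rintro c ⟨γ', h, rfl⟩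
    exact ofReal_le_worstCaseTime h hv

theorem isOptimalWorstCaseCost_of_three_le {n : ℕ} (hn : 3 ≤ n) :
    IsOptimalWorstCaseCost n (ENNReal.ofReal (1 / cos (π / n))) := by
  have hpi := pi_pos
  have hn' : (3 : ℝ) ≤ n := by exact_mod_cast hn
  have hlt : π / n < π / 2 := div_lt_div_of_pos_left hpi two_pos (by linarith)
  have hn0 : 0 ≤ π / n := by positivity
  have hc : 0 < cos (π / n) := cos_pos_of_mem_Ioo ⟨by linarith, hlt⟩
  refine isOptimalWorstCaseCost_of (γ := fun i t => t • circlePoint (2 * π * i / n))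
    (fun i => ⟨zero_smul _ _, ?_⟩) (fun θ => ?_) fun ls h => exists_one_div_cos_le_pathLength hn h
  · exact hasUnitSpeedOn_of_eqOn_line (p := 0) (a := 0)
      (norm_circlePoint (2 * π * i / n)) fun t _ => by simp
  · obtain ⟨i, ω, h1, h2, h3⟩ := exists_rotation (n := n) (by omega) (-(π / n)) θ
    refine ⟨i, 1 / cos (π / n), by positivity, le_rfl, ?_⟩
    rw [h3, real_inner_smul_left, inner_circlePoint_circlePoint, one_div,
      ← div_eq_inv_mul, le_div_iff₀ hc, one_mul]
    rw [show 2 * π * i / n - (2 * π * i / n + ω) = -ω by ring, cos_neg, ← cos_abs ω]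
    refine cos_le_cos_of_nonneg_of_le_pi (abs_nonneg _) (by linarith) (abs_le.2 ⟨h1, ?_⟩)
    rw [mul_div_assoc] at h2
    linarith

/-- The trajectory that leaves the centre in direction `φ` up to distance `2 / √3`, turns onto a
tangent of the circle, follows the circle for an arc of length `α` and leaves it along the
tangent. -/
def hookTrajectory (φ α t : ℝ) : Plane :=
  if t ≤ 2 / √3 then t • circlePoint φ
  else if t ≤ √3 then (2 / √3) • circlePoint φ + (t - 2 / √3) • circlePoint (φ + 2 * π / 3)
  else if t ≤ √3 + α then circlePoint (φ + π / 6 - √3 + t)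
  else circlePoint (φ + π / 6 + α) + (t - (√3 + α)) • circlePoint (φ + π / 6 + α + π / 2)

/-- The tangent leg has length `1 / √3 = tan (π / 6)` and direction `π / 6 + π / 2` relative to `φ`,
so it touches the circle at `φ + π / 6`. -/
theorem two_div_sqrt_three_add (φ : ℝ) :
    (2 / √3) • circlePoint φ + (√3 - 2 / √3) • circlePoint (φ + 2 * π / 3)
      = circlePoint (φ + π / 6) := by
  have h3 : √3 ^ 2 = 3 := sq_sqrt (by norm_num)
  have h30 : √3 ≠ 0 := by positivity
  have e : 2 * π / 3 = π - π / 3 := by ring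
  have hc : cos (2 * π / 3) = -(1 / 2) := by rw [e, cos_pi_sub, cos_pi_div_three]
  have hs : sin (2 * π / 3) = √3 / 2 := by rw [e, sin_pi_sub, sin_pi_div_three]
  have e' : √3 - 2 / √3 = 1 / √3 := by
    field_simp
    linarith
  have e2 : 2 / √3 = 2 * √3 / 3 := by field_simp; linarith
  have e1 : 1 / √3 = √3 / 3 := by field_simp; linarith
  rw [e', e1, e2]
  ext i
  fin_cases i
  · simp [circlePoint, cos_add, hc, hs]
    linear_combination (- sin φ / 6) * h3
  · simp [circlePoint, sin_add, hc, hs]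
    linear_combination (cos φ / 6) * h3

theorem isTrajectory_hookTrajectory (φ : ℝ) {α : ℝ} (hα : 0 ≤ α) :
    IsTrajectory (hookTrajectory φ α) := by
  have h3 : √3 ^ 2 = 3 := sq_sqrt (by norm_num)
  have h30 : 0 < √3 := by positivity
  have h1 : 0 < 2 / √3 := by positivity
  have h2 : 2 / √3 < √3 := by rw [div_lt_iff₀ h30]; nlinarith
  refine ⟨by simp [hookTrajectory, h1.le], ?_⟩
  have s1 : HasUnitSpeedOn (hookTrajectory φ α) (Set.Icc 0 (2 / √3)) := by
    refine hasUnitSpeedOn_of_eqOn_line (p := 0) (a := 0) (norm_circlePoint φ) fun t ht => ?_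
    rw [hookTrajectory, if_pos ht.2, zero_add, sub_zero]
  have s2 : HasUnitSpeedOn (hookTrajectory φ α) (Set.Icc (2 / √3) √3) := by
    refine hasUnitSpeedOn_of_eqOn_line (p := (2 / √3) • circlePoint φ) (a := 2 / √3)
      (norm_circlePoint (φ + 2 * π / 3)) fun t ht => ?_
    rcases ht.1.eq_or_lt with rfl | h
    · simp [hookTrajectory]
    · rw [hookTrajectory, if_neg (not_le.2 h), if_pos ht.2]
  have s3 : HasUnitSpeedOn (hookTrajectory φ α) (Set.Icc √3 (√3 + α)) := by
    refine hasUnitSpeedOn_of_eqOn_circle (a := φ + π / 6 - √3) fun t ht => ?_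
    rcases ht.1.eq_or_lt with rfl | h
    · rw [hookTrajectory, if_neg (not_le.2 h2), if_pos le_rfl, two_div_sqrt_three_add,
        sub_add_cancel]
    · rw [hookTrajectory, if_neg (not_le.2 (h2.trans h)), if_neg (not_le.2 h), if_pos ht.2]
  have s4 : HasUnitSpeedOn (hookTrajectory φ α) (Set.Ici (√3 + α)) := by
    refine hasUnitSpeedOn_of_eqOn_line (p := circlePoint (φ + π / 6 + α)) (a := √3 + α)
      (norm_circlePoint (φ + π / 6 + α + π / 2)) fun t ht => ?_
    rw [Set.mem_Ici] at ht
    rcases ht.eq_or_lt with rfl | h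
    · rcases hα.eq_or_lt with rfl | hα
      · rw [hookTrajectory, if_neg (by linarith), if_pos (by linarith), add_zero, add_zero,
          two_div_sqrt_three_add, sub_self, zero_smul, add_zero]
      · rw [hookTrajectory, if_neg (by linarith), if_neg (by linarith), if_pos le_rfl, sub_self,
          zero_smul, add_zero]
        congr 1
        ring
    · rw [hookTrajectory, if_neg (by linarith), if_neg (by linarith), if_neg (by linarith)]
  have s := ((s1.Icc_Icc s2).Icc_Icc s3).union s4 (x := √3 + α)
    ⟨⟨by linarith, le_rfl⟩, fun _ h => h.2⟩ ⟨Set.self_mem_Ici, fun _ h => h⟩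
  rwa [Set.Icc_union_Ici_eq_Ici (by linarith)] at s

/-- The turning point sees `±π / 6`, the circular arc sees itself, and the point at tangent distance
1 past it sees another `π / 2`. The sector has width `5 * π / 6 + α`. -/
theorem exists_inspects_hookTrajectory (φ : ℝ) {α ω : ℝ} (hα : 0 ≤ α) (h1 : -(π / 6) ≤ ω)
    (h2 : ω ≤ 2 * π / 3 + α) :
    ∃ t, 0 ≤ t ∧ t ≤ 1 + √3 + α ∧
      1 ≤ inner ℝ (hookTrajectory φ α t) (circlePoint (φ + ω)) := by
  have hpi := pi_pos
  have h3 : √3 ^ 2 = 3 := sq_sqrt (by norm_num)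
  have h30 : 0 < √3 := by positivity
  have h4 : 0 < 2 / √3 := by positivity
  have h5 : 2 / √3 < √3 := by rw [div_lt_iff₀ h30]; nlinarith
  rcases le_total ω (π / 6) with h | h
  · refine ⟨2 / √3, h4.le, by linarith, ?_⟩
    rw [hookTrajectory, if_pos le_rfl, real_inner_smul_left, inner_circlePoint_circlePoint,
      ← cos_neg, show -(φ - (φ + ω)) = ω by ring]
    have h6 : √3 / 2 ≤ cos ω := by
      rw [← cos_pi_div_six, ← cos_abs ω]
      exact cos_le_cos_of_nonneg_of_le_pi (abs_nonneg _) (by linarith) (abs_le.2 ⟨h1, h⟩)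
    calc (1 : ℝ) = 2 / √3 * (√3 / 2) := by field_simp
      _ ≤ _ := by gcongr
  rcases le_total ω (π / 6 + α) with h' | h'
  · refine ⟨√3 + (ω - π / 6), by linarith, by linarith, ?_⟩
    have e : hookTrajectory φ α (√3 + (ω - π / 6)) = circlePoint (φ + ω) := by
      rcases h.eq_or_lt with rfl | h
      · rw [hookTrajectory, if_neg (by linarith), if_pos (by linarith), sub_self, add_zero,
          two_div_sqrt_three_add]
      · rw [hookTrajectory, if_neg (by linarith), if_neg (by linarith), if_pos (by linarith)]
        congr 1
        ring
    rw [e, inner_circlePoint_circlePoint, sub_self, cos_zero]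
  · refine ⟨1 + √3 + α, by linarith, le_rfl, ?_⟩
    rw [hookTrajectory, if_neg (by linarith), if_neg (by linarith), if_neg (by linarith),
      inner_add_left, real_inner_smul_left, inner_circlePoint_circlePoint,
      inner_circlePoint_circlePoint]
    obtain ⟨z, rfl⟩ : ∃ z, ω = π / 6 + α + z := ⟨ω - (π / 6 + α), by ring⟩
    have hz : 0 ≤ z := by linarith
    have hz' : z ≤ π / 2 := by linarith
    rw [show φ + π / 6 + α - (φ + (π / 6 + α + z)) = -z by ring,
      show φ + π / 6 + α + π / 2 - (φ + (π / 6 + α + z)) = π / 2 - z by ring, cos_neg,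
      cos_pi_div_two_sub, show 1 + √3 + α - (√3 + α) = 1 by ring, one_mul]
    have hc := cos_nonneg_of_mem_Icc (x := z) ⟨by linarith, hz'⟩
    have hs := sin_nonneg_of_nonneg_of_le_pi hz (by linarith)
    -- In the first quadrant `cos z + sin z ≥ 1`.
    nlinarith [sin_sq_add_cos_sq z]

theorem isOptimalWorstCaseCost_of_le_two {n : ℕ} (hn : n = 1 ∨ n = 2) :
    IsOptimalWorstCaseCost n (ENNReal.ofReal (1 + √3 + 2 * π / n - 5 * π / 6)) := by
  have hpi := pi_pos
  -- This makes each agent's sector exactly `2 * π / n` wide, so the rotated copies cover the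
  -- circle.
  obtain ⟨α, hα⟩ : ∃ α, α = 2 * π / n - 5 * π / 6 := ⟨_, rfl⟩
  have hα0 : 0 ≤ α := by
    rcases hn with rfl | rfl
    · rw [hα, Nat.cast_one]; linarith
    · rw [hα, Nat.cast_ofNat]; linarith
  refine isOptimalWorstCaseCost_of (γ := fun i => hookTrajectory (2 * π * i / n) α)
    (fun i => isTrajectory_hookTrajectory _ hα0) (fun θ => ?_)
    fun ls h => exists_cost_le_pathLength hn h
  obtain ⟨i, ω, h1, h2, h3⟩ := exists_rotation (n := n) (by omega) (-(π / 6)) θ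
  obtain ⟨t, h4, h5, h6⟩ := exists_inspects_hookTrajectory (2 * π * i / n) hα0 h1
    (by linarith)
  exact ⟨i, t, h4, by linarith, h3 ▸ h6⟩

end DiskInspection

end

theorem theorem2 :
    (∀ n : ℕ, n = 1 ∨ n = 2 →
      DiskInspection.IsOptimalWorstCaseCost n
        (ENNReal.ofReal (1 + √3 + 2 * Real.pi / (n : ℝ) - 5 * Real.pi / 6))) ∧
    (∀ n : ℕ, 3 ≤ n →
      DiskInspection.IsOptimalWorstCaseCost n
        (ENNReal.ofReal (1 / Real.cos (Real.pi / (n : ℝ))))) :=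
  ⟨fun _ hn => DiskInspection.isOptimalWorstCaseCost_of_le_two hn,
    fun _ hn => DiskInspection.isOptimalWorstCaseCost_of_three_le hn⟩
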